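/- **Model (Bandit Social Learning).** There are two arms with mean rewards $\mu_1,\mu_2\in[0,1]$. Initially $N_0\ge 1$ independent samples of each arm $a$ are available, drawn from the Bernoulli distribution with mean $\mu_a$. In each round $t=1,\dots,T$ a new agent observes the history (the initial samples and the arm–reward pairs of the previous rounds) and draws a pair of indices $(\mathrm{Ind}_{1,t},\mathrm{Ind}_{2,t})\in\mathbb R^2$ from some probability distribution that depends on the history; the agent then chooses an arm $a_t$ with a largest index (ties are broken independently and uniformly at random), and a reward is drawn independently from the Bernoulli distribution with mean $\mu_{a_t}$; the pair of arm and reward is added to the history. For $\eta\ge 0$, the agent of round $t$ is *$\eta$-confident* if, for every history and almost surely for each arm $a$, $$\max\Big\{0,\ \hat\mu_{a,t}-\sqrt{\eta/n_{a,t}}\Big\}\ \le\ \mathrm{Ind}_{a,t}\ \le\ \min\Big\{1,\ \hat\mu_{a,t}+\sqrt{\eta/n_{a,t}}\Big\},$$ where $n_{a,t}$ is the number of samples of arm $a$ in the history (initial ones included) and $\hat\mu_{a,t}$ is their average. Different agents may behave differently. The *regret* is $\mathrm{Regret}(T)=\max(\mu_1,\mu_2)\cdot T-\mathbb E\big[\sum_{t=1}^T\mu_{a_t}\big]$.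 **Theorem.** For every $c\in(0,\tfrac12)$ there are constants $C_1,C_2>0$, depending only on $c$, such that the following holds. Let $\eta\ge0$, let $T$ and $N_0$ be numbers of rounds and of initial samples per arm, and let $\mu_1,\mu_2$ be mean rewards with $$c<\mu_2<\mu_1<1-c\qquad\text{and}\qquad N_0\ge \frac{64\,\eta}{c^2}+\frac1c .$$ Suppose that all $T$ agents are $\eta$-confident. Put $\Delta=\mu_1-\mu_2$ and $$p_{\mathrm{fail}}=C_1\Big(\Delta+\sqrt{\eta/N_0}\Big)\,e^{-C_2\left(\eta+N_0\Delta^2\right)} .$$ Then with probability at least $p_{\mathrm{fail}}$ all $T$ agents choose arm $2$ (that is, the good arm is never chosen). Consequently, $\mathrm{Regret}(T)\ge \Delta\cdot p_{\mathrm{fail}}\cdot T$. -/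

import Mathlib

namespace BanditSocialLearning

open MeasureTheory ProbabilityTheory

noncomputable section

/-- The history observed in round `t` (rounds are numbered `0, 1, 2, …`) when `N₀` initial samples
of each of the two arms are available: the 0/1 rewards of the initial samples, and the pairs
(chosen arm, 0/1 reward) of the `t` previous rounds. A reward `1` is coded by `true`. -/
abbrev History (N₀ t : ℕ) : Type :=
  (Fin 2 → Fin N₀ → Bool) × (Fin t → Fin 2 × Bool)

variable {N₀ t : ℕ}

/-- The number of samples of arm `a` in the history, including the initial ones. -/
def sampleCount (h : History N₀ t) (a : Fin 2) : ℕ :=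
  N₀ + (Finset.univ.filter fun s => (h.2 s).1 = a).card

/-- The average reward of arm `a` in the history, including the initial samples. -/
def avgReward (h : History N₀ t) (a : Fin 2) : ℝ :=
  ((∑ i, if h.1 a i = true then (1 : ℝ) else 0) +
      ∑ s, if (h.2 s).1 = a ∧ (h.2 s).2 = true then (1 : ℝ) else 0) /
    (sampleCount h a : ℝ)

/-- The (truncated) upper confidence bound for arm `a`. -/
def ucb (η : ℝ) (h : History N₀ t) (a : Fin 2) : ℝ :=
  min 1 (avgReward h a + √(η / (sampleCount h a : ℝ)))

/-- The (truncated) lower confidence bound for arm `a`. -/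
def lcb (η : ℝ) (h : History N₀ t) (a : Fin 2) : ℝ :=
  max 0 (avgReward h a - √(η / (sampleCount h a : ℝ)))

/-- The way an agent arriving in round `t` draws her pair of indices, one per arm: a joint law for
every history. Deterministic agents are those for which all these laws are Dirac masses. -/
abbrev Behavior (N₀ t : ℕ) : Type :=
  History N₀ t → ProbabilityMeasure (Fin 2 → ℝ)

/-- An agent is `η`-confident if both of her indices always lie in the `η`-confidence intervals. -/
def Behavior.IsConfident (η : ℝ) (β : Behavior N₀ t) : Prop :=
  ∀ h : History N₀ t, ∀ᵐ x ∂(β h : Measure (Fin 2 → ℝ)),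
    ∀ a : Fin 2, x a ∈ Set.Icc (lcb η h a) (ucb η h a)

/-- The set of arms with a largest index. -/
def bestArms (x : Fin 2 → ℝ) : Finset (Fin 2) :=
  Finset.univ.filter fun a => ∀ b, x b ≤ x a

theorem bestArms_nonempty (x : Fin 2 → ℝ) : (bestArms x).Nonempty := by
  obtain ⟨a, ha⟩ := Finite.exists_max x
  exact ⟨a, by simpa [bestArms] using ha⟩

/-- The law of the chosen arm when the indices are given: an arm with a largest index is chosen,
and ties are broken uniformly at random. -/
def armGivenIndices (x : Fin 2 → ℝ) : PMF (Fin 2) :=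
  PMF.uniformOfFinset (bestArms x) (bestArms_nonempty x)

theorem measurable_armGivenIndices (a : Fin 2) :
    Measurable fun x : Fin 2 → ℝ => armGivenIndices x a := by
  have hset : ∀ b : Fin 2, MeasurableSet {x : Fin 2 → ℝ | b ∈ bestArms x} := by
    intro b
    simp only [bestArms, Finset.mem_filter, Finset.mem_univ, true_and]
    exact MeasurableSet.iInter (fun i => measurableSet_le (measurable_pi_apply i)
      (measurable_pi_apply b)) |>.congr (by ext; simp)
  have hcard : Measurable fun x : Fin 2 → ℝ => ((bestArms x).card : ENNReal) := by
    have : (fun x : Fin 2 → ℝ => ((bestArms x).card : ENNReal)) =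
        fun x => ∑ b : Fin 2, Set.indicator {x | b ∈ bestArms x} (fun _ => (1 : ENNReal)) x := by
      funext x
      simp [Set.indicator_apply]
    rw [this]
    exact Finset.measurable_sum _ fun b _ => measurable_const.indicator (hset b)
  have : (fun x : Fin 2 → ℝ => armGivenIndices x a) =
      Set.indicator {x | a ∈ bestArms x} (fun x => ((bestArms x).card : ENNReal)⁻¹) := by
    funext x
    simp [armGivenIndices, PMF.uniformOfFinset_apply, Set.indicator_apply]
  rw [this]
  exact hcard.inv.indicator (hset a)

/-- The law of the chosen arm when the pair of indices is drawn from `ν`: the mixture over `ν` of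
the laws given the indices. -/
def armLaw (ν : ProbabilityMeasure (Fin 2 → ℝ)) : PMF (Fin 2) :=
  PMF.ofFintype (fun a => ∫⁻ x, armGivenIndices x a ∂(ν : Measure (Fin 2 → ℝ))) (by
    rw [← lintegral_finsetSum _ fun a _ => measurable_armGivenIndices a]
    have : ∀ x, ∑ a, armGivenIndices x a = 1 := fun x => by
      rw [← tsum_fintype (L := .unconditional _)]; exact (armGivenIndices x).tsum_coe
    simp [this])

/-- The Bernoulli law, with mean `μ a`, of a reward of arm `a`. -/
def rewardLaw (μ : Fin 2 → unitInterval) (a : Fin 2) : PMF Bool :=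
  (bernoulliMeasure true false (μ a)).toPMF

/-- The law of the initial samples: all of them are independent, and those of arm `a` are Bernoulli
with mean `μ a`. -/
def initialLaw (N₀ : ℕ) (μ : Fin 2 → unitInterval) : PMF (Fin 2 → Fin N₀ → Bool) :=
  (Measure.pi fun a => Measure.pi fun _ : Fin N₀ => (rewardLaw μ a).toMeasure).toPMF

/-- The law of the history after `T` rounds, when the arms have mean rewards `μ` and the agent of
round `t` behaves according to `β t`. In each round the agent draws her indices given the
history, an arm with a largest index is chosen, its reward is drawn from its Bernoulli law, and
the pair (arm, reward) is appended to the history. -/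
def historyLaw (μ : Fin 2 → unitInterval) (β : ∀ t : ℕ, Behavior N₀ t) :
    ∀ T : ℕ, PMF (History N₀ T)
  | 0 => (initialLaw N₀ μ).map fun r => (r, Fin.elim0)
  | T + 1 => (historyLaw μ β T).bind fun h =>
      (armLaw (β T h)).bind fun a =>
        (rewardLaw μ a).map fun r => (h.1, Fin.snoc h.2 (a, r))

/-- The `n`-sampling failure: all but at most `n` agents choose the bad arm, which is arm `1`
(arm `0` is the good one). -/
def samplingFailure (N₀ T n : ℕ) : Set (History N₀ T) :=
  {h | (Finset.univ.filter fun s => (h.2 s).1 ≠ 1).card ≤ n}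

/-- The (expected) regret after `T` rounds:
`max (μ 0) (μ 1) * T - 𝔼 [∑ t, μ (a t)]`. -/
def regret (μ : Fin 2 → unitInterval) (β : ∀ t : ℕ, Behavior N₀ t) (T : ℕ) : ℝ :=
  max (μ 0 : ℝ) (μ 1 : ℝ) * T -
    ∫ h, ∑ s, (μ (h.2 s).1 : ℝ) ∂(historyLaw μ β T).toMeasure

end

end BanditSocialLearning

/-!
Write `s = √(η / N₀)` and let `q = μ 1 - ε`, with a drift `ε` of order `Δ + s`. The good arm is never
chosen if two events occur:

* the initial average of arm `0` is at most `q - 2 s`;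
* the running average of arm `1` stays above `q` in every round.

Indeed, the confidence radii are at most `s` as there are at least `N₀` samples of each arm, so the
confidence intervals of the two arms are then disjoint (`ucb_lt_lcb`), and every `η`-confident agent
picks arm `1`.

The second event has probability of order `ε`. Let `S` be the sum and `n` the number of the samples
of arm `1`. Since the mean exceeds `q` by `ε`, the process `exp (-ε (S - q n))` is a supermartingale
(`bernoulli_exp_drift_le_one`), and therefore the positive part of `1 - exp (-ε (S - q n))` is a
submartingale. It is positive exactly when the average of arm `1` exceeds `q`, which is when the
agent is forced to pick arm `1`. This makes it possible to follow the history directly, without a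
tape of rewards drawn in advance: the `survivalPotential` of a history is a submartingale along the
process (`survivalPotential_le_step`), and its final expectation is at most the probability of
failure (`tsum_survivalPotential_le`). Its initial expectation factors over the two arms
(`tsum_initialLaw_survivalPotential`), and the factor of arm `1` is bounded below by the event that
the first sample is a success (`le_sum_sampleWeight_posPart`).

The first event gives the exponential factor (`le_sum_sampleWeight_lowerTail`). Under a Bernoulli law
whose mean is lower than `q - 2 s` by `2 / √N₀` (or is `0`), it has probability at least `1 / 2`, and the
Cauchy–Schwarz inequality transfers this to the true mean at the price of the `χ²`-divergence of the
product laws (`sq_sum_sampleWeight_le`), which is at most `exp (O (1 + η + N₀ Δ ^ 2))`.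
-/

namespace BanditSocialLearning

open MeasureTheory ProbabilityTheory

noncomputable section

/-! ### Sums of independent Bernoulli samples -/

/-- The mass that the Bernoulli law with mean `p` gives to a 0/1 outcome (`1` is `true`). -/
def bernoulliWeight (p : ℝ) (b : Bool) : ℝ := if b = true then p else 1 - p

/-- The mass that the law of `n` independent Bernoulli samples with mean `p` gives to a tuple of
outcomes. -/
def sampleWeight (p : ℝ) {n : ℕ} (r : Fin n → Bool) : ℝ := ∏ i, bernoulliWeight p (r i)

/-- The number of successes in a tuple of 0/1 outcomes, as a real number. -/
def successes {n : ℕ} (r : Fin n → Bool) : ℝ := ∑ i, if r i = true then (1 : ℝ) else 0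

theorem bernoulliWeight_nonneg {p : ℝ} (h0 : 0 ≤ p) (h1 : p ≤ 1) (b : Bool) :
    0 ≤ bernoulliWeight p b := by
  unfold bernoulliWeight
  split_ifs <;> linarith

theorem sampleWeight_nonneg {p : ℝ} (h0 : 0 ≤ p) (h1 : p ≤ 1) {n : ℕ} (r : Fin n → Bool) :
    0 ≤ sampleWeight p r :=
  Finset.prod_nonneg fun _ _ => bernoulliWeight_nonneg h0 h1 _

theorem sum_prod_bool (n : ℕ) (f : Bool → ℝ) :
    ∑ r : Fin n → Bool, ∏ i, f (r i) = (f true + f false) ^ n := by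
  have h := Finset.prod_univ_sum (fun _ : Fin n => (Finset.univ : Finset Bool)) fun _ b => f b
  rw [Fintype.piFinset_univ] at h
  rw [← h]
  simp

theorem sum_sampleWeight (p : ℝ) (n : ℕ) : ∑ r : Fin n → Bool, sampleWeight p r = 1 := by
  unfold sampleWeight
  rw [sum_prod_bool]
  simp [bernoulliWeight]

/-- A weak form of Hoeffding's lemma. -/
theorem bernoulli_centered_mgf_le {p l : ℝ} (h0 : 0 ≤ p) (h1 : p ≤ 1) (hl : |l| ≤ 1) :
    p * Real.exp (l * (1 - p)) + (1 - p) * Real.exp (l * (0 - p)) ≤ Real.exp (l ^ 2 / 4) := by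
  have key : ∀ x : ℝ, |x| ≤ 1 → Real.exp x ≤ 1 + x + x ^ 2 := fun x hx => by
    have := (abs_le.mp (Real.abs_exp_sub_one_sub_id_le hx)).2
    linarith
  have ha : |l * (1 - p)| ≤ 1 := by
    rw [abs_mul, abs_of_nonneg (sub_nonneg.mpr h1)]
    nlinarith [abs_nonneg l]
  have hb : |l * (0 - p)| ≤ 1 := by
    rw [zero_sub, abs_mul, abs_neg, abs_of_nonneg h0]
    nlinarith [abs_nonneg l]
  have h2 := mul_le_mul_of_nonneg_left (key _ ha) h0
  have h3 := mul_le_mul_of_nonneg_left (key _ hb) (sub_nonneg.mpr h1)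
  have h4 := Real.add_one_le_exp (l ^ 2 / 4)
  nlinarith [mul_nonneg (sq_nonneg l) (sq_nonneg (2 * p - 1))]

theorem bernoulli_mgf_le {p q l : ℝ} (h0 : 0 ≤ p) (h1 : p ≤ 1) (hl : |l| ≤ 1) :
    p * Real.exp (l * (1 - q)) + (1 - p) * Real.exp (l * (0 - q)) ≤
      Real.exp (l ^ 2 / 4 + l * (p - q)) := by
  have e1 : Real.exp (l * (1 - q)) = Real.exp (l * (1 - p)) * Real.exp (l * (p - q)) := by
    rw [← Real.exp_add]
    congr 1
    ring
  have e2 : Real.exp (l * (0 - q)) = Real.exp (l * (0 - p)) * Real.exp (l * (p - q)) := by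
    rw [← Real.exp_add]
    congr 1
    ring
  rw [e1, e2, Real.exp_add, ← mul_assoc, ← mul_assoc, ← add_mul]
  exact mul_le_mul_of_nonneg_right (bernoulli_centered_mgf_le h0 h1 hl) (Real.exp_pos _).le

/-- The process `exp (-ε (S - q n))` is a supermartingale when the drift satisfies `p - q = ε`. -/
theorem bernoulli_exp_drift_le_one {p ε : ℝ} (h0 : 0 ≤ p) (h1 : p ≤ 1) (hε0 : 0 ≤ ε)
    (hε1 : ε ≤ 1) :
    p * Real.exp (-ε * (1 - (p - ε))) + (1 - p) * Real.exp (-ε * (0 - (p - ε))) ≤ 1 := by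
  refine (bernoulli_mgf_le h0 h1 (by rwa [abs_neg, abs_of_nonneg hε0])).trans ?_
  rw [← Real.exp_zero]
  gcongr
  nlinarith [sq_nonneg ε]

theorem sampleWeight_mul_exp (p q l : ℝ) {n : ℕ} (r : Fin n → Bool) :
    sampleWeight p r * Real.exp (l * (successes r - q * n)) =
      ∏ i, bernoulliWeight p (r i) *
        Real.exp (l * ((if r i = true then (1 : ℝ) else 0) - q)) := by
  rw [Finset.prod_mul_distrib, ← Real.exp_sum, ← Finset.mul_sum, Finset.sum_sub_distrib]
  simp [sampleWeight, successes, mul_comm]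

theorem sum_sampleWeight_mul_exp (p q l : ℝ) (n : ℕ) :
    ∑ r : Fin n → Bool, sampleWeight p r * Real.exp (l * (successes r - q * n)) =
      (p * Real.exp (l * (1 - q)) + (1 - p) * Real.exp (l * (0 - q))) ^ n := by
  simp_rw [sampleWeight_mul_exp]
  rw [sum_prod_bool n fun b =>
    bernoulliWeight p b * Real.exp (l * ((if b = true then (1 : ℝ) else 0) - q))]
  simp [bernoulliWeight]

theorem sum_fin_succ_bool {n : ℕ} (f : (Fin (n + 1) → Bool) → ℝ) :
    ∑ r, f r = ∑ r : Fin n → Bool, (f (Fin.cons true r) + f (Fin.cons false r)) := by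
  rw [← (Fin.consEquiv fun _ : Fin (n + 1) => Bool).sum_comp, Fintype.sum_prod_type,
    Fintype.sum_bool, Finset.sum_add_distrib]
  rfl

/-- With probability of order `ε`, measured through the positive part of `1 - exp (-ε (S - q n))`,
the sum of `n ≥ 1` Bernoulli samples of mean `p` stays above the line of slope `q = p - ε`. The
bound comes from the samples whose first outcome is a success. -/
theorem le_sum_sampleWeight_posPart {p ε : ℝ} (h0 : 0 ≤ p) (h1 : p ≤ 1) (hε0 : 0 ≤ ε)
    (hε1 : ε ≤ 1) {n : ℕ} (hn : 0 < n) :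
    p * (1 - Real.exp (-ε * (1 - (p - ε)))) ≤
      ∑ r : Fin n → Bool,
        sampleWeight p r * max 0 (1 - Real.exp (-ε * (successes r - (p - ε) * n))) := by
  obtain ⟨m, rfl⟩ : ∃ m, n = m + 1 := ⟨n - 1, by omega⟩
  have hw : ∀ (b : Bool) (r : Fin m → Bool),
      sampleWeight p (Fin.cons b r : Fin (m + 1) → Bool) =
        bernoulliWeight p b * sampleWeight p r := fun b r => by
    simp [sampleWeight, Fin.prod_univ_succ]
  have hs : ∀ r : Fin m → Bool,
      successes (Fin.cons true r : Fin (m + 1) → Bool) = 1 + successes r := fun r => by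
    simp only [successes, Fin.sum_univ_succ, Fin.cons_zero, Fin.cons_succ, if_true]
  have hsum : ∑ r : Fin m → Bool, sampleWeight p r *
      Real.exp (-ε * (successes r - (p - ε) * m)) ≤ 1 := by
    rw [sum_sampleWeight_mul_exp]
    refine pow_le_one₀ ?_ (bernoulli_exp_drift_le_one h0 h1 hε0 hε1)
    have := sub_nonneg.mpr h1
    positivity
  rw [sum_fin_succ_bool]
  calc p * (1 - Real.exp (-ε * (1 - (p - ε))))
      ≤ p * (1 - Real.exp (-ε * (1 - (p - ε))) * ∑ r : Fin m → Bool, sampleWeight p r *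
          Real.exp (-ε * (successes r - (p - ε) * m))) := by
        gcongr
        exact mul_le_of_le_one_right (Real.exp_pos _).le hsum
    _ = ∑ r : Fin m → Bool, p * sampleWeight p r *
          (1 - Real.exp (-ε * (1 + successes r - (p - ε) * ((m + 1 : ℕ) : ℝ)))) := by
        nth_rewrite 1 [← sum_sampleWeight p m]
        rw [Finset.mul_sum, ← Finset.sum_sub_distrib, Finset.mul_sum]
        refine Finset.sum_congr rfl fun r _ => ?_
        have : Real.exp (-ε * (1 + successes r - (p - ε) * ((m + 1 : ℕ) : ℝ))) =
            Real.exp (-ε * (1 - (p - ε))) * Real.exp (-ε * (successes r - (p - ε) * m)) := by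
          rw [← Real.exp_add]
          congr 1
          push_cast
          ring
        rw [this]
        ring
    _ ≤ _ := by
        refine Finset.sum_le_sum fun r _ => ?_
        have hr := sampleWeight_nonneg h0 h1 r
        rw [hw, hw, hs]
        refine le_add_of_le_of_nonneg ?_ (mul_nonneg (mul_nonneg
          (bernoulliWeight_nonneg h0 h1 _) hr) (le_max_left _ _))
        simp only [bernoulliWeight, if_true]
        gcongr
        exact le_max_right _ _

/-! ### Lower tails of Bernoulli sums -/

/-- Chernoff's bound: a Bernoulli sum is at most `x n` with probability at least `1 / 2` once `x`
exceeds the mean by `2 / √n`. -/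
theorem half_le_sum_sampleWeight {p x : ℝ} (h0 : 0 ≤ p) (h1 : p ≤ 1) {n : ℕ} (hn : 0 < n)
    (hx : p + 2 / √n ≤ x) :
    1 / 2 ≤ ∑ r : Fin n → Bool with successes r ≤ x * n, sampleWeight p r := by
  have hn1 : (1 : ℝ) ≤ n := by exact_mod_cast hn
  have hsq : (0 : ℝ) < √n := Real.sqrt_pos.mpr (by linarith)
  have hsq1 : (1 : ℝ) ≤ √n := Real.one_le_sqrt.mpr hn1
  have hss : √(n : ℝ) * √n = n := Real.mul_self_sqrt (by linarith)
  set l : ℝ := 1 / √n with hl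
  have hl0 : 0 < l := by positivity
  have hl1 : l ≤ 1 := by rw [hl, div_le_one hsq]; exact hsq1
  have hln : l ^ 2 * n = 1 := by
    rw [hl, div_pow, sq √(n : ℝ), hss]
    field_simp
  have hcompl : ∑ r : Fin n → Bool with ¬ successes r ≤ x * n, sampleWeight p r ≤ 1 / 2 := by
    calc ∑ r : Fin n → Bool with ¬ successes r ≤ x * n, sampleWeight p r
        ≤ ∑ r : Fin n → Bool with ¬ successes r ≤ x * n,
            sampleWeight p r * Real.exp (l * (successes r - x * n)) := by
          refine Finset.sum_le_sum fun r hr => ?_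
          have hr' := not_le.mp (Finset.mem_filter.mp hr).2
          refine le_mul_of_one_le_right (sampleWeight_nonneg h0 h1 r) (Real.one_le_exp ?_)
          exact mul_nonneg hl0.le (by linarith)
      _ ≤ ∑ r : Fin n → Bool, sampleWeight p r * Real.exp (l * (successes r - x * n)) :=
          Finset.sum_le_sum_of_subset_of_nonneg (Finset.filter_subset _ _) fun r _ _ =>
            mul_nonneg (sampleWeight_nonneg h0 h1 r) (Real.exp_pos _).le
      _ ≤ Real.exp (l ^ 2 / 4 + l * (p - x)) ^ n := by
          rw [sum_sampleWeight_mul_exp]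
          refine pow_le_pow_left₀ ?_ (bernoulli_mgf_le h0 h1 (by rwa [abs_of_pos hl0])) _
          have := sub_nonneg.mpr h1
          positivity
      _ ≤ Real.exp (-1) := by
          rw [← Real.exp_nat_mul]
          gcongr
          have : 2 * l ≤ x - p := by
            rw [hl]
            linarith [hx, (by ring : 2 * (1 / √(n : ℝ)) = 2 / √n)]
          nlinarith [mul_le_mul_of_nonneg_left this (by positivity : 0 ≤ l * n)]
      _ ≤ 1 / 2 := by
          rw [Real.exp_neg, inv_eq_one_div]
          have := Real.add_one_le_exp (1 : ℝ)
          exact one_div_le_one_div_of_le (by norm_num) (by linarith)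
  have htot := Finset.sum_filter_add_sum_filter_not (Finset.univ : Finset (Fin n → Bool))
    (fun r => successes r ≤ x * n) (fun r => sampleWeight p r)
  rw [sum_sampleWeight] at htot
  linarith

/-- Change of measure: by the Cauchy–Schwarz inequality, an event that is likely for samples of
mean `p'` is not too unlikely for samples of mean `p`, the loss being governed by the
`χ²`-divergence of the two product laws. -/
theorem sq_sum_sampleWeight_le {p p' : ℝ} (h0 : 0 < p) (h1 : p < 1) {n : ℕ}
    (s : Finset (Fin n → Bool)) :
    (∑ r ∈ s, sampleWeight p' r) ^ 2 ≤
      (∑ r ∈ s, sampleWeight p r) * Real.exp (n * ((p - p') ^ 2 / (p * (1 - p)))) := by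
  have hpos : ∀ b, 0 < bernoulliWeight p b := fun b => by
    unfold bernoulliWeight
    split_ifs <;> linarith
  have hposw : ∀ r : Fin n → Bool, 0 < sampleWeight p r := fun r =>
    Finset.prod_pos fun _ _ => hpos _
  have hdiv : ∑ r : Fin n → Bool, sampleWeight p' r ^ 2 / sampleWeight p r ≤
      Real.exp (n * ((p - p') ^ 2 / (p * (1 - p)))) := by
    have : ∀ r : Fin n → Bool, sampleWeight p' r ^ 2 / sampleWeight p r =
        ∏ i, (bernoulliWeight p' (r i) ^ 2 / bernoulliWeight p (r i)) := fun r => by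
      rw [Finset.prod_div_distrib, Finset.prod_pow, sampleWeight, sampleWeight]
    simp_rw [this]
    rw [sum_prod_bool n fun b => bernoulliWeight p' b ^ 2 / bernoulliWeight p b, Real.exp_nat_mul]
    have h1' : 0 < 1 - p := by linarith
    have e : bernoulliWeight p' true ^ 2 / bernoulliWeight p true +
        bernoulliWeight p' false ^ 2 / bernoulliWeight p false =
          (p - p') ^ 2 / (p * (1 - p)) + 1 := by
      simp only [bernoulliWeight, if_true, Bool.false_eq_true, if_false]
      field_simp
      ring
    rw [e]
    gcongr
    exact Real.add_one_le_exp _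
  calc (∑ r ∈ s, sampleWeight p' r) ^ 2
      ≤ (∑ r ∈ s, sampleWeight p r) * ∑ r ∈ s, sampleWeight p' r ^ 2 / sampleWeight p r :=
        Finset.sum_sq_le_sum_mul_sum_of_sq_le_mul s (fun r _ => (hposw r).le)
          (fun r _ => div_nonneg (sq_nonneg _) (hposw r).le)
          fun r _ => (mul_div_cancel₀ _ (hposw r).ne').ge
    _ ≤ _ := by
        refine mul_le_mul_of_nonneg_left (le_trans ?_ hdiv)
          (Finset.sum_nonneg fun r _ => (hposw r).le)
        exact Finset.sum_le_sum_of_subset_of_nonneg (Finset.subset_univ _)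
          fun r _ _ => div_nonneg (sq_nonneg _) (hposw r).le

/-- Anti-concentration of the Bernoulli average below its mean. -/
theorem le_sum_sampleWeight_lowerTail {p x : ℝ} (h0 : 0 < p) (h1 : p < 1) (hx0 : 0 ≤ x)
    (hxp : x ≤ p) {n : ℕ} (hn : 0 < n) :
    1 / 4 * Real.exp (-(n * (p - x + 2 / √n) ^ 2 / (p * (1 - p)))) ≤
      ∑ r : Fin n → Bool with successes r ≤ x * n, sampleWeight p r := by
  -- Near zero there is no room for a deviation `2 / √n`, but then no success at all is certain
  -- under the tilted mean.
  set p' : ℝ := max 0 (x - 2 / √n) with hp'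
  have hd : (0 : ℝ) ≤ 2 / √n := by positivity
  have hp'x : p' ≤ x := max_le hx0 (by linarith)
  have hp'0 : 0 ≤ p' := le_max_left _ _
  have hhalf : 1 / 2 ≤ ∑ r : Fin n → Bool with successes r ≤ x * n, sampleWeight p' r := by
    rcases le_total (x - 2 / √n) 0 with h | h
    · have hz : p' = 0 := max_eq_left h
      have hmem : (fun _ => false : Fin n → Bool) ∈
          Finset.univ.filter fun r : Fin n → Bool => successes r ≤ x * n := by
        simpa [successes] using (by positivity : 0 ≤ x * n)
      have := Finset.single_le_sum (f := fun r : Fin n → Bool => sampleWeight p' r)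
        (fun r _ => sampleWeight_nonneg hp'0 (by linarith) r) hmem
      refine le_trans ?_ this
      simp only [sampleWeight, bernoulliWeight, hz]
      norm_num
    · refine half_le_sum_sampleWeight hp'0 (by linarith) hn ?_
      rw [hp', max_eq_right h]
      linarith
  have hcs := sq_sum_sampleWeight_le (p' := p') h0 h1
    (Finset.univ.filter fun r : Fin n → Bool => successes r ≤ x * n)
  have hq : (1 / 4 : ℝ) ≤ (∑ r : Fin n → Bool with successes r ≤ x * n, sampleWeight p' r) ^ 2 := by
    nlinarith
  have hP : 0 ≤ ∑ r : Fin n → Bool with successes r ≤ x * n, sampleWeight p r :=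
    Finset.sum_nonneg fun r _ => sampleWeight_nonneg h0.le h1.le r
  have hexp : Real.exp (n * ((p - p') ^ 2 / (p * (1 - p)))) ≤
      Real.exp (n * (p - x + 2 / √n) ^ 2 / (p * (1 - p))) := by
    have h1' : 0 < p * (1 - p) := mul_pos h0 (by linarith)
    have : x - 2 / √n ≤ p' := le_max_right _ _
    rw [← mul_div_assoc]
    gcongr
    · linarith
    · linarith
  rw [Real.exp_neg, ← div_eq_mul_inv, div_le_iff₀ (Real.exp_pos _)]
  exact hq.trans (hcs.trans (mul_le_mul_of_nonneg_left hexp hP))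

/-! ### Laws of the rewards and of the initial samples -/

theorem tsum_bind_mul {α γ : Type*} (p : PMF α) (f : α → PMF γ) (g : γ → ENNReal) :
    ∑' y, p.bind f y * g y = ∑' x, p x * ∑' y, f x y * g y := by
  simp_rw [PMF.bind_apply, ← ENNReal.tsum_mul_right, ← ENNReal.tsum_mul_left]
  rw [ENNReal.tsum_comm]
  simp_rw [mul_assoc]

theorem tsum_map_mul {α γ : Type*} (p : PMF α) (f : α → γ) (g : γ → ENNReal) :
    ∑' y, p.map f y * g y = ∑' x, p x * g (f x) := by
  classical
  rw [← PMF.bind_pure_comp, tsum_bind_mul]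
  refine tsum_congr fun x => ?_
  congr 1
  rw [tsum_eq_single (f x)]
  · simp
  · intro y hy
    simp [PMF.pure_apply, hy]

theorem rewardLaw_apply (μ : Fin 2 → unitInterval) (a : Fin 2) (b : Bool) :
    rewardLaw μ a b = ENNReal.ofReal (bernoulliWeight (μ a) b) := by
  have h : ∀ p : unitInterval, ((unitInterval.toNNReal p : NNReal) : ENNReal) =
      ENNReal.ofReal (p : ℝ) := fun p => by
    rw [ENNReal.ofReal, ENNReal.coe_inj, Real.toNNReal_of_nonneg p.2.1]
    rfl
  rw [rewardLaw, Measure.toPMF_apply, bernoulliMeasure_apply _ (measurableSet_singleton b)]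
  cases b <;> simp [bernoulliWeight, h]

theorem initialLaw_apply {N₀ : ℕ} (μ : Fin 2 → unitInterval) (r : Fin 2 → Fin N₀ → Bool) :
    initialLaw N₀ μ r =
      ENNReal.ofReal (sampleWeight (μ 0) (r 0) * sampleWeight (μ 1) (r 1)) := by
  have h : ∀ a, ∏ i, (rewardLaw μ a).toMeasure {r a i} =
      ENNReal.ofReal (sampleWeight (μ a) (r a)) := fun a => by
    rw [sampleWeight, ENNReal.ofReal_prod_of_nonneg
      fun i _ => bernoulliWeight_nonneg (μ a).2.1 (μ a).2.2 _]
    refine Finset.prod_congr rfl fun i _ => ?_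
    rw [PMF.toMeasure_apply_singleton _ _ (measurableSet_singleton _), rewardLaw_apply]
  rw [initialLaw, Measure.toPMF_apply, Measure.pi_singleton]
  simp_rw [Measure.pi_singleton, h]
  rw [Fin.prod_univ_two, ENNReal.ofReal_mul (sampleWeight_nonneg (μ 0).2.1 (μ 0).2.2 _)]

/-! ### The survival potential -/

variable {N₀ t : ℕ}

/-- The sum of the rewards of arm `a` in the history, including the initial samples. -/
def totalReward (h : History N₀ t) (a : Fin 2) : ℝ :=
  successes (h.1 a) + ∑ s, if (h.2 s).1 = a ∧ (h.2 s).2 = true then (1 : ℝ) else 0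

theorem avgReward_eq (h : History N₀ t) (a : Fin 2) :
    avgReward h a = totalReward h a / (sampleCount h a : ℝ) := rfl

theorem le_sampleCount (h : History N₀ t) (a : Fin 2) : N₀ ≤ sampleCount h a :=
  Nat.le_add_right _ _

theorem sampleCount_snoc (h : History N₀ t) (a : Fin 2) (b : Bool) (a' : Fin 2) :
    sampleCount ((h.1, Fin.snoc h.2 (a, b)) : History N₀ (t + 1)) a' =
      sampleCount h a' + if a = a' then 1 else 0 := by
  simp only [sampleCount, Finset.card_filter, Fin.sum_univ_castSucc, Fin.snoc_castSucc,
    Fin.snoc_last, add_assoc]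

theorem totalReward_snoc (h : History N₀ t) (a : Fin 2) (b : Bool) (a' : Fin 2) :
    totalReward ((h.1, Fin.snoc h.2 (a, b)) : History N₀ (t + 1)) a' =
      totalReward h a' + if a = a' ∧ b = true then 1 else 0 := by
  simp only [totalReward, Fin.sum_univ_castSucc, Fin.snoc_castSucc, Fin.snoc_last, add_assoc]

/-- If the index of arm `1` is almost surely the larger one, then arm `1` is chosen. -/
theorem armLaw_eq_one {ν : ProbabilityMeasure (Fin 2 → ℝ)}
    (h : ∀ᵐ x ∂(ν : Measure (Fin 2 → ℝ)), x 0 < x 1) : armLaw ν 1 = 1 := by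
  have h1 : ∀ᵐ x ∂(ν : Measure (Fin 2 → ℝ)), armGivenIndices x 1 = 1 := by
    filter_upwards [h] with x hx
    have : bestArms x = {1} := by
      ext a
      fin_cases a <;> simp [bestArms, Fin.forall_fin_two, hx, hx.le]
    simp [armGivenIndices, PMF.uniformOfFinset_apply, this]
  simp only [armLaw, PMF.ofFintype_apply]
  rw [lintegral_congr_ae h1]
  simp

/-- The survival potential of a history. It vanishes as soon as arm `0` has been chosen, or if the
average of arm `0` exceeds `θ`; otherwise it is the positive part of `1 - exp (-ε (S - q n))`,
with `S` the sum and `n` the number of the samples of arm `1`. For confident agents, and with `θ`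
far enough below `q = μ 1 - ε`, it bounds from below the conditional probability that arm `0` is not
chosen later on. -/
def survivalPotential (ε q θ : ℝ) (h : History N₀ t) : ENNReal :=
  if (∀ s, (h.2 s).1 = 1) ∧ totalReward h 0 ≤ θ * sampleCount h 0 then
    ENNReal.ofReal (1 - Real.exp (-ε * (totalReward h 1 - q * sampleCount h 1)))
  else 0

/-- While arm `0` looks bad and the average of arm `1` exceeds `q`, the confidence intervals of the
two arms are separated. -/
theorem ucb_lt_lcb {η q θ : ℝ} (hN : 0 < N₀) (hη : 0 ≤ η) (hθ : θ + 2 * √(η / N₀) ≤ q)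
    {h : History N₀ t} (h0 : totalReward h 0 ≤ θ * sampleCount h 0)
    (h1 : q * sampleCount h 1 < totalReward h 1) : ucb η h 0 < lcb η h 1 := by
  have hpos : ∀ a, (0 : ℝ) < sampleCount h a := fun a => by
    exact_mod_cast hN.trans_le (le_sampleCount h a)
  have hs : ∀ a, √(η / sampleCount h a) ≤ √(η / N₀) := fun a => by
    have : (N₀ : ℝ) ≤ sampleCount h a := by exact_mod_cast le_sampleCount h a
    have : (0 : ℝ) < N₀ := by exact_mod_cast hN
    gcongr
  have e0 : avgReward h 0 ≤ θ := by rwa [avgReward_eq, div_le_iff₀ (hpos 0)]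
  have e1 : q < avgReward h 1 := by rwa [avgReward_eq, lt_div_iff₀ (hpos 1)]
  refine (min_le_right _ _).trans_lt (lt_of_lt_of_le ?_ (le_max_right _ _))
  linarith [hs 0, hs 1]

/-- The survival potential is a submartingale. -/
theorem survivalPotential_le_step {η ε θ : ℝ} (μ : Fin 2 → unitInterval) (hN : 0 < N₀)
    (hη : 0 ≤ η) (hε0 : 0 < ε) (hε1 : ε ≤ 1) (hθ : θ + 2 * √(η / N₀) ≤ (μ 1 : ℝ) - ε)
    {β : Behavior N₀ t} (hβ : β.IsConfident η) (h : History N₀ t) :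
    survivalPotential ε (μ 1 - ε) θ h ≤
      ∑' a, armLaw (β h) a * ∑' b, rewardLaw μ a b *
        survivalPotential ε (μ 1 - ε) θ ((h.1, Fin.snoc h.2 (a, b)) : History N₀ (t + 1)) := by
  set q : ℝ := μ 1 - ε with hq
  set D : ℝ := totalReward h 1 - q * sampleCount h 1 with hD
  by_cases hc : (∀ s, (h.2 s).1 = 1) ∧ totalReward h 0 ≤ θ * sampleCount h 0
  swap
  · rw [survivalPotential, if_neg hc]
    exact zero_le
  rcases le_or_gt D 0 with hD0 | hD0
  · rw [survivalPotential, if_pos hc, ← hD, ENNReal.ofReal_of_nonpos]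
    · exact zero_le
    · linarith [Real.one_le_exp (by nlinarith : 0 ≤ -ε * D)]
  have harm : armLaw (β h) 1 = 1 := by
    refine armLaw_eq_one ?_
    filter_upwards [hβ h] with x hx
    exact (hx 0).2.trans_lt ((ucb_lt_lcb hN hη hθ hc.2 (sub_pos.mp hD0)).trans_le (hx 1).1)
  have hstep : ∀ b : Bool, survivalPotential ε q θ
      ((h.1, Fin.snoc h.2 (1, b)) : History N₀ (t + 1)) =
        ENNReal.ofReal (1 - Real.exp (-ε * (D + ((if b = true then 1 else 0) - q)))) := by
    intro b
    have hall : ∀ s : Fin (t + 1),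
        ((Fin.snoc h.2 (1, b) : Fin (t + 1) → Fin 2 × Bool) s).1 = 1 := fun s => by
      refine Fin.lastCases ?_ (fun s => ?_) s
      · simp
      · simpa using hc.1 s
    have hlow : totalReward ((h.1, Fin.snoc h.2 (1, b)) : History N₀ (t + 1)) 0 ≤
        θ * sampleCount ((h.1, Fin.snoc h.2 (1, b)) : History N₀ (t + 1)) 0 := by
      rw [totalReward_snoc, sampleCount_snoc]
      simpa using hc.2
    rw [survivalPotential, if_pos ⟨hall, hlow⟩]
    congr 4
    rw [totalReward_snoc, sampleCount_snoc, hD]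
    simp only [true_and, if_true, Nat.cast_add, Nat.cast_one]
    ring
  refine le_trans ?_ (ENNReal.le_tsum 1)
  rw [harm, one_mul, tsum_fintype, Fintype.sum_bool, rewardLaw_apply, rewardLaw_apply, hstep, hstep,
    survivalPotential, if_pos hc, ← hD]
  have hp0 : (0 : ℝ) ≤ μ 1 := (μ 1).2.1
  have hp1 : (μ 1 : ℝ) ≤ 1 := (μ 1).2.2
  rw [← ENNReal.ofReal_mul (bernoulliWeight_nonneg hp0 hp1 _),
    ← ENNReal.ofReal_mul (bernoulliWeight_nonneg hp0 hp1 _)]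
  refine le_trans (ENNReal.ofReal_le_ofReal ?_) ENNReal.ofReal_add_le
  have hdrift := mul_le_mul_of_nonneg_left (bernoulli_exp_drift_le_one hp0 hp1 hε0.le hε1)
    (Real.exp_pos (-ε * D)).le
  simp only [bernoulliWeight, if_true, Bool.false_eq_true, if_false, mul_add, Real.exp_add]
  rw [← hq] at hdrift
  linarith

theorem tsum_survivalPotential_mono {η ε θ : ℝ} (μ : Fin 2 → unitInterval) (hN : 0 < N₀)
    (hη : 0 ≤ η) (hε0 : 0 < ε) (hε1 : ε ≤ 1) (hθ : θ + 2 * √(η / N₀) ≤ (μ 1 : ℝ) - ε)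
    (β : ∀ t : ℕ, Behavior N₀ t) (T : ℕ) (hβ : ∀ t < T, (β t).IsConfident η) :
    ∑' r, initialLaw N₀ μ r *
        survivalPotential ε (μ 1 - ε) θ ((r, Fin.elim0) : History N₀ 0) ≤
      ∑' h, historyLaw μ β T h * survivalPotential ε (μ 1 - ε) θ h := by
  induction T with
  | zero => rw [historyLaw, tsum_map_mul]
  | succ T ih =>
    refine (ih fun t ht => hβ t (by omega)).trans ?_
    rw [historyLaw, tsum_bind_mul]
    refine ENNReal.tsum_le_tsum fun h => ?_
    gcongr
    refine (survivalPotential_le_step μ hN hη hε0 hε1 hθ (hβ T (by omega)) h).trans_eq ?_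
    rw [tsum_bind_mul]
    refine tsum_congr fun a => ?_
    rw [tsum_map_mul]

/-! ### Probability and cost of failure -/

theorem mem_samplingFailure_zero {h : History N₀ t} :
    h ∈ samplingFailure N₀ t 0 ↔ ∀ s, (h.2 s).1 = 1 := by
  simp [samplingFailure, Finset.filter_eq_empty_iff]

theorem tsum_survivalPotential_le (ε q θ : ℝ) (p : PMF (History N₀ t)) :
    ∑' h, p h * survivalPotential ε q θ h ≤ p.toMeasure (samplingFailure N₀ t 0) := by
  rw [PMF.toMeasure_apply_eq_tsum]
  refine ENNReal.tsum_le_tsum fun h => ?_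
  by_cases hc : (∀ s, (h.2 s).1 = 1) ∧ totalReward h 0 ≤ θ * sampleCount h 0
  · rw [Set.indicator_of_mem (mem_samplingFailure_zero.mpr hc.1), survivalPotential, if_pos hc]
    refine mul_le_of_le_one_right' (ENNReal.ofReal_le_one.mpr ?_)
    linarith [Real.exp_pos (-ε * (totalReward h 1 - q * sampleCount h 1))]
  · rw [survivalPotential, if_neg hc, mul_zero]
    exact zero_le

/-- The two arms have independent initial samples, so the initial expectation of the survival
potential is a product. -/
theorem tsum_initialLaw_survivalPotential (μ : Fin 2 → unitInterval) (ε q θ : ℝ) :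
    ∑' r, initialLaw N₀ μ r * survivalPotential ε q θ ((r, Fin.elim0) : History N₀ 0) =
      ENNReal.ofReal ((∑ r : Fin N₀ → Bool with successes r ≤ θ * N₀, sampleWeight (μ 0) r) *
        ∑ r : Fin N₀ → Bool, sampleWeight (μ 1) r *
          max 0 (1 - Real.exp (-ε * (successes r - q * N₀)))) := by
  have hw : ∀ a (r : Fin N₀ → Bool), 0 ≤ sampleWeight (μ a) r := fun a r =>
    sampleWeight_nonneg (μ a).2.1 (μ a).2.2 r
  have hr : ∀ r : Fin 2 → Fin N₀ → Bool, initialLaw N₀ μ r *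
      survivalPotential ε q θ ((r, Fin.elim0) : History N₀ 0) =
        ENNReal.ofReal ((if successes (r 0) ≤ θ * N₀ then sampleWeight (μ 0) (r 0) else 0) *
          (sampleWeight (μ 1) (r 1) *
            max 0 (1 - Real.exp (-ε * (successes (r 1) - q * N₀))))) := fun r => by
    have hc : ∀ a, sampleCount ((r, Fin.elim0) : History N₀ 0) a = N₀ := fun a => by
      simp [sampleCount]
    have ht : ∀ a, totalReward ((r, Fin.elim0) : History N₀ 0) a = successes (r a) := fun a => by
      simp [totalReward]
    simp only [survivalPotential, hc, ht, initialLaw_apply, IsEmpty.forall_iff, true_and]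
    split_ifs
    · rw [← mul_assoc, ENNReal.ofReal_mul (mul_nonneg (hw _ _) (hw _ _)), max_comm]
      congr 1
      rw [ENNReal.ofReal_max, ENNReal.ofReal_zero, max_eq_left (zero_le)]
    · simp
  rw [tsum_fintype, Finset.sum_congr rfl fun r _ => hr r, ← ENNReal.ofReal_sum_of_nonneg]
  · rw [← (finTwoArrowEquiv _).symm.sum_comp, Fintype.sum_prod_type, Finset.sum_filter,
      Finset.sum_mul_sum]
    rfl
  · intro r _
    refine mul_nonneg ?_ (mul_nonneg (hw _ _) (le_max_left _ _))
    split_ifs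
    exacts [hw _ _, le_rfl]

/-- Failure costs `μ 0 - μ 1` in every round. -/
theorem mul_failure_le_regret (μ : Fin 2 → unitInterval) (hμ : (μ 1 : ℝ) ≤ μ 0)
    (β : ∀ t : ℕ, Behavior N₀ t) (T : ℕ) :
    ((μ 0 : ℝ) - μ 1) * (historyLaw μ β T).toMeasure.real (samplingFailure N₀ T 0) * T ≤
      regret μ β T := by
  have hm : ∀ s : Set (History N₀ T), MeasurableSet s := fun s => s.to_countable.measurableSet
  have hle : ∫ h, ∑ s, (μ (h.2 s).1 : ℝ) ∂(historyLaw μ β T).toMeasure ≤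
      ∫ h, ((μ 0 : ℝ) * T - (samplingFailure N₀ T 0).indicator
        (fun _ => ((μ 0 : ℝ) - μ 1) * T) h) ∂(historyLaw μ β T).toMeasure := by
    refine integral_mono (.of_finite) (.of_finite) fun h => ?_
    by_cases hf : h ∈ samplingFailure N₀ T 0
    · simp only [Set.indicator_of_mem hf]
      rw [Finset.sum_congr rfl fun s _ => by rw [mem_samplingFailure_zero.mp hf s]]
      simp
      linarith
    · simp only [Set.indicator_of_notMem hf, sub_zero]
      have : ∀ a, (μ a : ℝ) ≤ μ 0 := fun a => by
        fin_cases a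
        exacts [le_rfl, hμ]
      refine (Finset.sum_le_sum fun s _ => this _).trans_eq ?_
      simp [mul_comm]
  rw [integral_sub (integrable_const _) (.of_finite), integral_indicator_const _ (hm _)] at hle
  simp only [integral_const, probReal_univ, smul_eq_mul, one_mul] at hle
  rw [regret, max_eq_left hμ]
  linarith

/-! ### Choice of the constants -/

theorem half_le_one_sub_exp_neg {y : ℝ} (h0 : 0 ≤ y) (h1 : y ≤ 1) :
    y / 2 ≤ 1 - Real.exp (-y) := by
  have h : Real.exp (-y) ≤ (1 + y)⁻¹ := by
    rw [Real.exp_neg]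
    exact inv_anti₀ (by linarith) (by linarith [Real.add_one_le_exp y])
  have h2 : (1 + y)⁻¹ ≤ 1 - y / 2 := by
    rw [inv_le_iff_one_le_mul₀ (by linarith)]
    nlinarith
  linarith

/-- The exponential factor of the failure probability: the chance that the initial average of arm
`0` is at most `x`, where `x` lies below `p` by a constant multiple of `Δ + √(η / n)` at most. -/
theorem le_sum_sampleWeight_lowerTail_of_gap {c p x Δ η : ℝ} (hc0 : 0 < c) (hc1 : c < 1 / 2)
    (hpc : c < p) (hpc' : p < 1 - c) (hx0 : 0 ≤ x) (hxp : x ≤ p) (hη : 0 ≤ η) {n : ℕ}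
    (hn : 0 < n) (hx : p - x ≤ 2 * Δ + 3 * √(η / n)) :
    1 / 4 * Real.exp (-(24 / c)) * Real.exp (-(54 / c * (η + n * Δ ^ 2))) ≤
      ∑ r : Fin n → Bool with successes r ≤ x * n, sampleWeight p r := by
  refine le_trans ?_
    (le_sum_sampleWeight_lowerTail (hc0.trans hpc) (by linarith) hx0 hxp hn)
  rw [mul_assoc, ← Real.exp_add]
  have hn' : (0 : ℝ) < n := by exact_mod_cast hn
  have hs : √(η / n) ^ 2 * n = η := by
    rw [Real.sq_sqrt (by positivity), div_mul_cancel₀ _ hn'.ne']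
  have hd : (2 / √(n : ℝ)) ^ 2 * n = 4 := by
    rw [div_pow, Real.sq_sqrt hn'.le, div_mul_cancel₀ _ hn'.ne']
    norm_num
  set s := √(η / n)
  set d := 2 / √(n : ℝ) with hdd
  have hd0 : 0 ≤ d := by positivity
  have hvar : c / 2 ≤ p * (1 - p) := by nlinarith
  have hsq : (p - x + d) ^ 2 ≤ 3 * ((2 * Δ) ^ 2 + (3 * s) ^ 2 + d ^ 2) := by
    calc (p - x + d) ^ 2 ≤ (2 * Δ + 3 * s + d) ^ 2 := by
          have := sub_nonneg.mpr hxp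
          gcongr
      _ ≤ _ := by
          nlinarith [sq_nonneg (2 * Δ - 3 * s), sq_nonneg (2 * Δ - d), sq_nonneg (3 * s - d)]
  have hnum : n * (p - x + d) ^ 2 ≤ 12 * (n * Δ ^ 2) + 27 * η + 12 := by
    nlinarith [mul_le_mul_of_nonneg_left hsq hn'.le]
  have hΔ : 0 ≤ n * Δ ^ 2 := by positivity
  gcongr
  calc -(24 / c) + -(54 / c * (η + n * Δ ^ 2))
      ≤ -((12 * (n * Δ ^ 2) + 27 * η + 12) / (c / 2)) := by
        rw [← sub_nonneg]
        have : -((12 * (n * Δ ^ 2) + 27 * η + 12) / (c / 2)) -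
            (-(24 / c) + -(54 / c * (η + n * Δ ^ 2))) = 30 * (n * Δ ^ 2) / c := by
          field_simp
          ring
        rw [this]
        positivity
    _ ≤ -(n * (p - x + d) ^ 2 / (p * (1 - p))) := by
        gcongr

end

end BanditSocialLearning

open BanditSocialLearning in
theorem theorem3p2 (c : ℝ) (hc0 : 0 < c) (hc1 : c < 1 / 2) :
    ∃ C₁ C₂ : ℝ, 0 < C₁ ∧ 0 < C₂ ∧
      ∀ (η : ℝ) (N₀ T : ℕ) (μ : Fin 2 → unitInterval)
        (β : ∀ t : ℕ, BanditSocialLearning.Behavior N₀ t),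
        0 ≤ η →
        c < (μ 1 : ℝ) → (μ 1 : ℝ) < (μ 0 : ℝ) → (μ 0 : ℝ) < 1 - c →
        64 * η / c ^ 2 + 1 / c ≤ (N₀ : ℝ) →
        (∀ t < T, (β t).IsConfident η) →
        ∀ Δ pfail : ℝ,
          Δ = (μ 0 : ℝ) - (μ 1 : ℝ) →
          pfail = C₁ * (Δ + √(η / (N₀ : ℝ))) * Real.exp (-(C₂ * (η + (N₀ : ℝ) * Δ ^ 2))) →
          pfail ≤ (BanditSocialLearning.historyLaw μ β T).toMeasure.real
              (BanditSocialLearning.samplingFailure N₀ T 0) ∧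
            Δ * pfail * (T : ℝ) ≤ BanditSocialLearning.regret μ β T := by
  refine ⟨c ^ 3 / 64 * Real.exp (-(24 / c)), 54 / c, by positivity, by positivity, ?_⟩
  intro η N₀ T μ β hη hμc hμ hμc' hN hβ Δ pfail hΔ hp
  have hNr : (0 : ℝ) < N₀ := lt_of_lt_of_le (by positivity) hN
  have hN0 : 0 < N₀ := by exact_mod_cast hNr
  have hs8 : √(η / N₀) ≤ c / 8 := by
    rw [Real.sqrt_le_left (by positivity), div_le_iff₀ hNr]
    have h1 : 64 * η / c ^ 2 ≤ N₀ := by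
      linarith [(by positivity : 0 < 1 / c)]
    rw [div_le_iff₀ (by positivity)] at h1
    nlinarith
  have hs0 : 0 ≤ √(η / (N₀ : ℝ)) := Real.sqrt_nonneg _
  set s := √(η / (N₀ : ℝ)) with hs
  have hΔ0 : 0 < Δ := by linarith
  have hΔ1 : Δ < 1 := by linarith
  have hcΔ : c * Δ ≤ c := mul_le_of_le_one_right hc0.le hΔ1.le
  have hcΔ' : c * Δ ≤ Δ := mul_le_of_le_one_left hΔ0.le (by linarith)
  have hcs : c * s ≤ s := mul_le_of_le_one_left hs0 (by linarith)
  have hcΔ0 : 0 < c * Δ := mul_pos hc0 hΔ0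
  -- The drift `ε` is of order `Δ + s`, yet small enough for `μ 1 - ε - 2 * s` to be positive.
  set ε := s + c * Δ / 8 with hε
  have hε0 : 0 < ε := by linarith
  have hε1 : ε ≤ 1 := by linarith
  set x := (μ 1 : ℝ) - ε - 2 * s with hx
  have hA := le_sum_sampleWeight_lowerTail_of_gap (x := x) (Δ := Δ) hc0 hc1 (hμc.trans hμ) hμc'
    (by linarith) (by linarith) hη hN0 (by rw [← hs]; linarith)
  have hB : c ^ 3 / 16 * (Δ + s) ≤ ∑ r : Fin N₀ → Bool, sampleWeight (μ 1) r *
      max 0 (1 - Real.exp (-ε * (successes r - (μ 1 - ε) * N₀))) := by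
    refine le_trans ?_ (le_sum_sampleWeight_posPart (by linarith) (by linarith) hε0.le hε1 hN0)
    have h1 : ε * c ≤ ε * (1 - (μ 1 - ε)) := by
      gcongr
      linarith
    have h2 : ε * c / 2 ≤ 1 - Real.exp (-ε * (1 - (μ 1 - ε))) := by
      refine (half_le_one_sub_exp_neg (by positivity) (by nlinarith)).trans ?_
      gcongr
      linarith
    calc c ^ 3 / 16 * (Δ + s) = c * (c * (Δ + s) / 8 * c / 2) := by ring
      _ ≤ c * (ε * c / 2) := by
          gcongr
          linarith
      _ ≤ _ := mul_le_mul hμc.le h2 (by positivity) (hc0.le.trans hμc.le)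
  have hfail : pfail ≤ (historyLaw μ β T).toMeasure.real (samplingFailure N₀ T 0) := by
    have h := (tsum_survivalPotential_mono μ hN0 hη hε0 hε1 (θ := x)
      (by rw [← hs]; linarith) β T hβ).trans (tsum_survivalPotential_le _ _ _ _)
    rw [tsum_initialLaw_survivalPotential,
      ENNReal.ofReal_le_iff_le_toReal (MeasureTheory.measure_ne_top _ _)] at h
    refine le_trans ?_ h
    refine le_trans (le_of_eq ?_) (mul_le_mul hA hB (by positivity) (le_trans (by positivity) hA))
    rw [hp]
    ring
  refine ⟨hfail, le_trans ?_ (mul_failure_le_regret μ hμ.le β T)⟩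
  rw [← hΔ]
  gcongr
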